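/- Let $k$ be a commutative ring and let $\mathscr{N}=\mathbb{N}^{\infty}$ be the poset of sequences $\mathbf{x}=(x_1,x_2,\ldots)$ of natural numbers with all but finitely many entries $0$, ordered entrywise ($\mathbf{x}\leqslant\mathbf{y}$ iff $x_i\leqslant y_i$ for all $i$) and regarded as a category. An $\mathscr{N}$-module is a covariant functor $\mathscr{N}\to k\text{-Mod}$, equivalently a presheaf of $k$-modules on $\mathscr{N}^{\mathrm{op}}$. Equip $\mathscr{N}^{\mathrm{op}}$ with the atomic topology $J_{at}$ (a sieve is covering iff it is nonempty), let $\mathrm{Sh}(\mathscr{N}^{\mathrm{op}},J_{at},\underline{k})$ be the category of sheaves of $k$-modules, let $\mathrm{inc}:\mathrm{Sh}(\mathscr{N}^{\mathrm{op}},J_{at},\underline{k})\to\mathscr{N}\text{-Mod}$ be the inclusion, and let the sheafification functor be its left adjoint. For $i\geqslant 1$ let $\mathbf{o}_i\in\mathscr{N}$ be the sequence with $i$-th entry $1$ and all other entries $0$. The $i$-th shift functor $\Sigma_i:\mathscr{N}\text{-Mod}\to\mathscr{N}\text{-Mod}$ is given by $(\Sigma_iV)_{\mathbf{x}}=V_{\mathbf{x}+\mathbf{o}_i}$,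 and the maps $V_{\mathbf{x}}\to V_{\mathbf{x}+\mathbf{o}_i}$ give a natural map $\phi^i_V:V\to\Sigma_iV$. Write $\Sigma_{[n]}=\Sigma_n\circ\cdots\circ\Sigma_1$ and let $\Sigma V$ be the colimit of the sequence $$V\xrightarrow{\phi^1_V}\Sigma_1V\xrightarrow{\phi^2_{\Sigma_1V}}\Sigma_{[2]}V\xrightarrow{\phi^3_{\Sigma_{[2]}V}}\Sigma_{[3]}V\to\cdots,$$ with natural map $\psi_V:V\to\Sigma V$. Let $\Sigma^{\infty}V$ be the colimit of the sequence $$V\xrightarrow{\psi_V}\Sigma V\xrightarrow{\psi_{\Sigma V}}\Sigma^2V\to\cdots,$$ with natural map $\boldsymbol{\psi}_V:V\to\Sigma^{\infty}V$; these constructions are functorial in $V$. Then $\Sigma^{\infty}V$ is a sheaf for every $\mathscr{N}$-module $V$, and the resulting functor $\Sigma^{\infty}:\mathscr{N}\text{-Mod}\to\mathrm{Sh}(\mathscr{N}^{\mathrm{op}},J_{at},\underline{k})$ is isomorphic to the sheafification functor. Moreover, $\Sigma^{\infty}$ is left adjoint to $\mathrm{inc}$ by an adjunction whose unit at $V$ is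 $\boldsymbol{\psi}_V$. -/

import Mathlib

open CategoryTheory CategoryTheory.Limits

universe u

namespace NInfty

noncomputable section

/-! ### Infinite composites of pointed endofunctors -/

section InfiniteComposite

variable {C : Type*} [Category C] (T : ℕ → (C ⥤ C)) (η : ∀ n, 𝟭 C ⟶ T n)

/-- The finite composite `T (n - 1) ∘ ⋯ ∘ T 1 ∘ T 0`. -/
def finComp : ℕ → (C ⥤ C)
  | 0 => 𝟭 C
  | n + 1 => finComp n ⋙ T n

/-- The natural transformation from the `n`-th finite composite to the next one, whose component
at `V` is the component of `η n` at the object `T (n - 1) ⋯ T 0 V`. -/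
def finCompStep (n : ℕ) : finComp T n ⟶ finComp T (n + 1) where
  app V := (η n).app ((finComp T n).obj V)
  naturality _ _ f := (η n).naturality ((finComp T n).map f)

/-- The functor sending `V` to the sequence `V ⟶ T 0 V ⟶ T 1 (T 0 V) ⟶ ⋯`. -/
def finCompSeq : C ⥤ (ℕ ⥤ C) :=
  (Functor.ofSequence (finCompStep T η)).flip

variable [HasColimitsOfShape ℕ C]

/-- The functor sending `V` to the colimit of the sequence `V ⟶ T 0 V ⟶ T 1 (T 0 V) ⟶ ⋯`. -/
def infComp : C ⥤ C := finCompSeq T η ⋙ colim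

/-- The natural map from `V` to the colimit of `V ⟶ T 0 V ⟶ T 1 (T 0 V) ⟶ ⋯`. -/
def toInfComp : 𝟭 C ⟶ infComp T η where
  app V := colimit.ι ((finCompSeq T η).obj V) 0
  naturality _ _ f := (ι_colimMap ((finCompSeq T η).map f) 0).symm

end InfiniteComposite

/-! ### Modules over the poset of finitely supported sequences -/

/-- The poset of finitely supported sequences of natural numbers with the entrywise order,
regarded as a category. -/
abbrev NInf : Type := ℕ →₀ ℕ

variable (k : Type u) [CommRing k]

/-- The category of covariant functors from the poset `NInf` to `k`-modules. -/
abbrev NMod : Type (u + 1) := NInf ⥤ ModuleCat.{u} k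

/-- The functor `x ↦ x + oᵢ`, where `oᵢ` is the sequence with `i`-th entry `1` and all other
entries `0`. -/
def translate (i : ℕ) : NInf ⥤ NInf :=
  Monotone.functor (f := fun x : NInf => x + Finsupp.single i 1)
    (fun _ _ h => add_le_add_left h _)

/-- The natural transformation with components `x ⟶ x + oᵢ`. -/
def toTranslate (i : ℕ) : 𝟭 NInf ⟶ translate i where
  app x := homOfLE (le_self_add : x ≤ x + Finsupp.single i 1)
  naturality _ _ _ := Subsingleton.elim _ _

/-- The shift functor `V ↦ V ∘ (x ↦ x + oᵢ)` along the `i`-th direction. -/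
def shift (i : ℕ) : NMod k ⥤ NMod k :=
  (Functor.whiskeringLeft _ _ _).obj (translate i)

/-- The natural map from `V` to its `i`-th shift, given at `x` by `V x ⟶ V (x + oᵢ)`. -/
def toShift (i : ℕ) : 𝟭 (NMod k) ⟶ shift k i :=
  (Functor.whiskeringLeft _ _ (ModuleCat.{u} k)).map (toTranslate i)

/-- The shift functor along all directions: the colimit of the sequence
`V ⟶ Σ₀ V ⟶ Σ₁ Σ₀ V ⟶ ⋯`. -/
def sigmaAll : NMod k ⥤ NMod k := infComp (shift k) (toShift k)

/-- The natural map from `V` to its shift along all directions. -/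
def toSigmaAll : 𝟭 (NMod k) ⟶ sigmaAll k := toInfComp (shift k) (toShift k)

/-- The infinite shift functor: the colimit of the sequence `V ⟶ Σ V ⟶ Σ (Σ V) ⟶ ⋯`, where
`Σ` is the shift functor along all directions. -/
def sigmaInf : NMod k ⥤ NMod k := infComp (fun _ => sigmaAll k) (fun _ => toSigmaAll k)

/-- The natural map from `V` to its infinite shift. -/
def toSigmaInf : 𝟭 (NMod k) ⟶ sigmaInf k :=
  toInfComp (fun _ => sigmaAll k) (fun _ => toSigmaAll k)

/-! ### Sheaves for the atomic topology -/

theorem rightOre_NInf_op : GrothendieckTopology.RightOreCondition NInfᵒᵖ := fun {_ Y Z} _ _ =>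
  ⟨Opposite.op (Y.unop ⊔ Z.unop), (homOfLE le_sup_left).op, (homOfLE le_sup_right).op,
    Subsingleton.elim _ _⟩

/-- The atomic topology on the opposite of the poset `NInf`: the covering sieves are exactly the
nonempty ones. -/
abbrev atomicTopology : GrothendieckTopology NInfᵒᵖ :=
  GrothendieckTopology.atomic rightOre_NInf_op

/-- The category of sheaves of `k`-modules for the atomic topology. -/
abbrev AtomicSheaf : Type (u + 1) := Sheaf atomicTopology (ModuleCat.{u} k)

instance hasSheafify_atomic : HasSheafify atomicTopology (ModuleCat.{u} k) :=
  hasSheafifyEssentiallySmallSite.{0, u, 0, u + 1, u} atomicTopology (ModuleCat.{u} k)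

/-- A covariant functor on `NInf` regarded as a presheaf on the opposite category. -/
def toPresheaf : NMod k ⥤ (NInfᵒᵖᵒᵖ ⥤ ModuleCat.{u} k) :=
  (Functor.whiskeringLeft _ _ _).obj (unopUnop NInf)

/-- The inclusion of sheaves of `k`-modules into functors on `NInf`. -/
def sheafInclusion : AtomicSheaf k ⥤ NMod k :=
  sheafToPresheaf atomicTopology (ModuleCat.{u} k) ⋙
    (Functor.whiskeringLeft _ _ _).obj (opOp NInf)

/-- The sheafification functor. -/
def sheafification : NMod k ⥤ AtomicSheaf k :=
  toPresheaf k ⋙ presheafToSheaf atomicTopology (ModuleCat.{u} k)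

/-- The infinite shift functor as a functor to sheaves, once its values are known to be
sheaves. -/
def sigmaInfSheaf
    (h : ∀ V : NMod k,
      Presheaf.IsSheaf atomicTopology ((toPresheaf k).obj ((sigmaInf k).obj V))) :
    NMod k ⥤ AtomicSheaf k where
  obj V := ⟨(toPresheaf k).obj ((sigmaInf k).obj V), h V⟩
  map f := ⟨(toPresheaf k).map ((sigmaInf k).map f)⟩

end

end NInfty

/-!
Since `NInf` is a directed preorder, the sheaves for the atomic topology on its opposite are exactly
the functors inverting every morphism (`isSheaf_iff_isLocallyConstant`): a nonempty sieve contains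
a sieve generated by one morphism `f`, for which there is no compatibility condition, so the sheaf
condition for `f` says that the functor inverts `f`. Call such functors locally constant.

The infinite shift of `V` is locally constant (`isLocallyConstant_sigmaInf`). Write `Σ` for the shift
along all directions. The unit `V ⟶ Σ V` factors through `V ⟶ Σᵢ V` for each `i`
(`exists_fac_toInfComp`), so along `x ⟶ x + oᵢ` the sequences `(Σⁿ V) x` and `(Σⁿ V) (x + oᵢ)` are
interleaved and have isomorphic colimits (`isIso_colimit_map`).

The unit from `V` to its infinite shift is local with respect to the locally constant functors
(`isLocal_toSigmaInf`), i.e. precomposition with it is a bijection on morphisms to them. For a single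
`Σᵢ` this holds because `Σᵢ` is a well-pointed endofunctor whose unit is invertible at every locally
constant functor (`isLocal_app_of_wellPointed`), and local morphisms are closed under transfinite
composition, which covers both sequential colimits (`isLocal_toInfComp`).

So the infinite shift is a reflection onto the sheaves with unit `toSigmaInf`, and uniqueness of left
adjoints identifies it with sheafification.
-/

namespace NInfty

noncomputable section

/-! ### Pointed endofunctors and their infinite composites -/

section InfiniteComposite

variable {C : Type*} [Category C]

/-- If a pointed endofunctor `(T, η)` is well-pointed at `V`, i.e. `T η = η T` there, then every
object `W` at which `η` is invertible is local with respect to `η` at `V`: a morphism `g : V ⟶ W`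
extends along `η` to `T g` followed by the inverse of `η`, and uniquely so since
`g' ≫ η = η ≫ T g' = T (η ≫ g')` for every extension `g'`. -/
theorem isLocal_app_of_wellPointed {T : C ⥤ C} (η : 𝟭 C ⟶ T) {P : ObjectProperty C}
    (hP : ∀ W, P W → IsIso (η.app W)) (V : C) (hV : T.map (η.app V) = η.app (T.obj V)) :
    P.isLocal (η.app V) := by
  intro W hW
  have := hP W hW
  refine ⟨fun g₁ g₂ h => ?_, fun g => ⟨T.map g ≫ inv (η.app W), ?_⟩⟩
  · have key (g : T.obj V ⟶ W) : g ≫ η.app W = T.map (η.app V ≫ g) := by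
      rw [Functor.map_comp, hV]
      exact η.naturality g
    dsimp only at h
    rw [← cancel_mono (η.app W), key, key, h]
  · have h := η.naturality g
    simp only [Functor.id_map] at h
    simp [← reassoc_of% h]

variable {T : ℕ → (C ⥤ C)} {η : ∀ n, 𝟭 C ⟶ T n}

theorem finCompSeq_map_succ (V : C) (n : ℕ) :
    ((finCompSeq T η).obj V).map (homOfLE (Nat.le_add_right n 1)) =
      (η n).app ((finComp T n).obj V) :=
  congr_app (Functor.ofSequence_map_homOfLE_succ (finCompStep T η) n) V

variable [HasColimitsOfShape ℕ C]

/-- The unit of an infinite composite is the transfinite composition of the units of its terms, so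
it is local as soon as they are. -/
theorem isLocal_toInfComp {P : ObjectProperty C} (h : ∀ n V, P.isLocal ((η n).app V)) (V : C) :
    P.isLocal ((toInfComp T η).app V) :=
  P.isLocal.transfiniteCompositionsOfShape_le ℕ _ ⟨
    { F := (finCompSeq T η).obj V
      isoBot := Iso.refl _
      incl := (colimit.cocone _).ι
      isColimit := colimit.isColimit _
      fac := Category.id_comp _
      map_mem := fun n _ => by
        have := h n ((finComp T n).obj V)
        rwa [← finCompSeq_map_succ] at this }⟩

/-- The unit of an infinite composite factors through the unit of each of its terms, even though
that term is applied only after the preceding ones. -/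
theorem exists_fac_toInfComp (n : ℕ) (V : C) :
    ∃ s : (T n).obj V ⟶ (infComp T η).obj V, (η n).app V ≫ s = (toInfComp T η).app V := by
  let S := (finCompSeq T η).obj V
  let c : V ⟶ (finComp T n).obj V := S.map (homOfLE n.zero_le)
  let ι₀ : (finComp T n).obj V ⟶ (infComp T η).obj V := colimit.ι S n
  let ι₁ : (T n).obj ((finComp T n).obj V) ⟶ (infComp T η).obj V := colimit.ι S (n + 1)
  have h₀ : c ≫ ι₀ = (toInfComp T η).app V := colimit.w S (homOfLE n.zero_le)
  have h₁ : (η n).app ((finComp T n).obj V) ≫ ι₁ = ι₀ := by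
    rw [← finCompSeq_map_succ]
    exact colimit.w S (homOfLE (Nat.le_add_right n 1))
  have h : (η n).app V ≫ (T n).map c = c ≫ (η n).app ((finComp T n).obj V) :=
    ((η n).naturality c).symm
  exact ⟨(T n).map c ≫ ι₁, by rw [reassoc_of% h, h₁, h₀]⟩

end InfiniteComposite

variable {k : Type u} [CommRing k]

/-! ### Sheaves for the atomic topology are the locally constant functors -/

/-- The functors on `NInf` that send every morphism to an isomorphism. -/
def isLocallyConstant (k : Type u) [CommRing k] : ObjectProperty (NMod k) :=
  fun W => ∀ ⦃x y : NInf⦄ (f : x ⟶ y), IsIso (W.map f)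

/-- The morphisms `x ⟶ x + oᵢ` generate the category `NInf`. -/
theorem isLocallyConstant_of_translate {W : NMod k}
    (h : ∀ i x, IsIso (W.map ((toTranslate i).app x))) : isLocallyConstant k W := by
  have key (d : NInf) : ∀ x, IsIso (W.map (homOfLE (le_self_add : x ≤ x + d))) := by
    induction d using Finsupp.induction_linear with
    | zero =>
      intro x
      have : homOfLE (le_self_add : x ≤ x + 0) = eqToHom (add_zero x).symm := Subsingleton.elim _ _
      rw [this]
      infer_instance
    | add d e hd he =>
      intro x
      have : homOfLE (le_self_add : x ≤ x + (d + e)) =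
          homOfLE (le_self_add : x ≤ x + d) ≫ homOfLE (le_self_add : x + d ≤ x + d + e) ≫
            eqToHom (add_assoc x d e) := Subsingleton.elim _ _
      have h₁ := hd x
      have h₂ := he (x + d)
      rw [this, W.map_comp, W.map_comp]
      infer_instance
    | single i n =>
      induction n with
      | zero =>
        intro x
        have : homOfLE (le_self_add : x ≤ x + Finsupp.single i 0) = eqToHom (by simp) :=
          Subsingleton.elim _ _
        rw [this]
        infer_instance
      | succ n hn =>
        intro x
        have e : (translate i).obj (x + Finsupp.single i n) = x + Finsupp.single i (n + 1) :=
          show x + _ + _ = _ by rw [add_assoc, ← Finsupp.single_add]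
        have : homOfLE (le_self_add : x ≤ x + Finsupp.single i (n + 1)) =
            homOfLE (le_self_add : x ≤ x + Finsupp.single i n) ≫ (toTranslate i).app _ ≫
              eqToHom e := Subsingleton.elim _ _
        have h₁ := hn x
        have h₂ := h i (x + Finsupp.single i n)
        have h₃ : IsIso (W.map (eqToHom e)) := inferInstance
        rw [this, W.map_comp, W.map_comp]
        exact IsIso.comp_isIso' h₁ (IsIso.comp_isIso' h₂ h₃)
  intro x y f
  obtain ⟨d, rfl⟩ := exists_add_of_le (leOfHom f)
  exact key d x

/-- A functor on `NInf` is a sheaf for the atomic topology if and only if it is locally constant.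
Every nonempty sieve contains a sieve generated by a single morphism `f`, and there is no
compatibility condition on an element over the source of `f` since the category is a preorder; so
the sheaf condition for `f` says that restriction along `f` is bijective. -/
theorem isSheaf_iff_isLocallyConstant (W : NMod k) :
    Presheaf.IsSheaf atomicTopology ((toPresheaf k).obj W) ↔ isLocallyConstant k W := by
  constructor
  · intro h x y f
    rw [isIso_iff_yoneda_map_bijective]
    intro E
    have hf := (Presieve.isSheafFor_iff_generate _).2
      (h E (Sieve.generate (Presieve.singleton f.op))
        ⟨_, f.op, Sieve.le_generate _ _ _ (Presieve.singleton_self _)⟩)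
    let G := (toPresheaf k).obj W ⋙ coyoneda.obj (Opposite.op E)
    have key (g : G.obj (Opposite.op (Opposite.op y))) : ∃! g', G.map f.op.op g' = g := by
      have := hf ((Presieve.FamilyOfElements.singletonEquiv G f.op).symm g)
        ((Presieve.FamilyOfElements.compatible_singleton_iff _ _).2 fun p₁ p₂ _ => by
          rw [Subsingleton.elim p₁ p₂])
      simpa only [Presieve.FamilyOfElements.isAmalgamation_singleton_iff,
        Presieve.FamilyOfElements.singletonEquiv_symm_apply_self] using this
    exact ⟨fun g₁ g₂ e => (key _).unique e rfl, fun g => (key g).exists⟩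
  · -- The amalgamation is determined by the component at one member `f` of the sieve; the other
    -- members are compared with `f` on a common refinement.
    rintro h E X S ⟨Y, f, hf⟩ x hx
    have hiso {Y Z : NInfᵒᵖ} (g : Y ⟶ Z) : IsIso (((toPresheaf k).obj W).map g.op) := h g.unop
    have := hiso f
    refine ⟨x f hf ≫ inv (((toPresheaf k).obj W).map f.op), fun Z g hg => ?_, fun t ht => ?_⟩
    · obtain ⟨U, a, b, hab⟩ := rightOre_NInf_op f g
      have := hiso b
      have hc := hx a b hf hg hab
      change x f hf ≫ ((toPresheaf k).obj W).map a.op =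
        x g hg ≫ ((toPresheaf k).obj W).map b.op at hc
      change (_ ≫ _) ≫ ((toPresheaf k).obj W).map g.op = _
      rw [← cancel_mono (((toPresheaf k).obj W).map b.op), ← hc, Category.assoc, Category.assoc,
        ← Functor.map_comp, ← op_comp, ← hab, op_comp, Functor.map_comp, IsIso.inv_hom_id_assoc]
    · have := ht f hf
      change t ≫ ((toPresheaf k).obj W).map f.op = _ at this
      rw [← this, Category.assoc, IsIso.hom_inv_id, Category.comp_id]

/-! ### The infinite shift is locally constant -/

/-- A morphism `f` of `NInf` is inverted in the colimit of a sequence `A` whenever each transition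
map `A n ⟶ A (n + 1)` factors, at the source and at the target of `f`, through the action of `f`:
the colimits at the source and at the target are then interleaved. -/
theorem isIso_colimit_map (A : ℕ ⥤ NMod k) {x y : NInf} (f : x ⟶ y)
    (h : ∀ n, ∃ s : (A.obj n).obj y ⟶ (A.obj (n + 1)).obj x,
      (A.obj n).map f ≫ s = (A.map (homOfLE (Nat.le_add_right n 1))).app x ∧
      s ≫ (A.obj (n + 1)).map f = (A.map (homOfLE (Nat.le_add_right n 1))).app y) :
    IsIso ((colimit A).map f) := by
  rw [ConcreteCategory.isIso_iff_bijective]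
  have : PreservesFilteredColimitsOfSize.{0, 0} (forget (ModuleCat.{u} k)) :=
    preservesFilteredColimitsOfSize_shrink.{0, u, 0, u} _
  have hcol (z : NInf) := isColimitOfPreserves ((evaluation _ (ModuleCat.{u} k)).obj z)
    (colimit.isColimit A)
  have hnat (n : ℕ) (v : (A.obj n).obj x) :
      (colimit A).map f ((colimit.ι A n).app x v) =
        (colimit.ι A n).app y ((A.obj n).map f v) :=
    (ConcreteCategory.congr_hom ((colimit.ι A n).naturality f) v).symm
  have hw {m n : ℕ} (g : m ⟶ n) (z : NInf) (v : (A.obj m).obj z) :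
      (colimit.ι A n).app z ((A.map g).app z v) = (colimit.ι A m).app z v :=
    ConcreteCategory.congr_hom (congr_app (colimit.w A g) z) v
  constructor
  · rw [injective_iff_map_eq_zero]
    intro w hw0
    obtain ⟨n, v, rfl⟩ := Concrete.isColimit_exists_rep _ (hcol x) w
    change (colimit A).map f ((colimit.ι A n).app x v) = 0 at hw0
    rw [hnat, ← map_zero ((colimit.ι A n).app y).hom] at hw0
    obtain ⟨m, g, g', hg⟩ := Concrete.isColimit_exists_of_rep_eq _ (hcol y) _ _ hw0
    change (A.map g).app y ((A.obj n).map f v) = (A.map g').app y 0 at hg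
    have hg' := (ConcreteCategory.congr_hom ((A.map g).naturality f) v).symm.trans hg
    change (A.obj m).map f ((A.map g).app x v) = _ at hg'
    -- The image of `v` in `A m` is killed by `f`, hence by the transition map to `A (m + 1)`,
    -- which factors through `f`.
    obtain ⟨s, hs, -⟩ := h m
    have hs' := ConcreteCategory.congr_hom hs ((A.map g).app x v)
    change s ((A.obj m).map f ((A.map g).app x v)) = _ at hs'
    change (colimit.ι A n).app x v = 0
    rw [hg', map_zero, map_zero] at hs'
    rw [← hw g, ← hw (homOfLE (Nat.le_add_right m 1)), ← hs', map_zero]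
  · intro w
    obtain ⟨n, v, rfl⟩ := Concrete.isColimit_exists_rep _ (hcol y) w
    obtain ⟨s, -, hs⟩ := h n
    refine ⟨(colimit.ι A (n + 1)).app x (s v), ?_⟩
    rw [hnat]
    exact (congrArg _ (ConcreteCategory.congr_hom hs v)).trans (hw _ y v)

/-- The shift functors are well-pointed, as `NInf` is a preorder. -/
theorem map_toShift (i : ℕ) (V : NMod k) :
    (shift k i).map ((toShift k i).app V) = (toShift k i).app ((shift k i).obj V) := by
  ext x : 2
  exact congrArg V.map (Subsingleton.elim _ _)

/-- For `U` in the sequence `V ⟶ Σ V ⟶ Σ (Σ V) ⟶ ⋯`, the unit `U ⟶ Σ U` factors through a morphism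
`s : Σᵢ U ⟶ Σ U`, whose component at `x` goes from `U (x + oᵢ)` to `(Σ U) x`. By naturality of `s`
along `x ⟶ x + oᵢ` these components interleave the values at `x` and at `x + oᵢ`. -/
theorem isLocallyConstant_sigmaInf (V : NMod k) : isLocallyConstant k ((sigmaInf k).obj V) := by
  refine isLocallyConstant_of_translate fun i x => isIso_colimit_map _ _ fun n => ?_
  let U : NMod k := (finComp (fun _ => sigmaAll k) n).obj V
  obtain ⟨s, hs⟩ := exists_fac_toInfComp (T := shift k) (η := toShift k) i U
  refine ⟨s.app x, ?_, ?_⟩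
  · rw [finCompSeq_map_succ]
    exact congr_app hs x
  · rw [finCompSeq_map_succ]
    refine (s.naturality ((toTranslate i).app x)).symm.trans ?_
    refine Eq.trans ?_ (congr_app hs ((translate i).obj x))
    exact congrArg (· ≫ _) (congrArg U.map (Subsingleton.elim _ _))

theorem isLocal_toSigmaInf (V : NMod k) :
    (isLocallyConstant k).isLocal ((toSigmaInf k).app V) :=
  isLocal_toInfComp (fun _ => isLocal_toInfComp fun i V =>
    isLocal_app_of_wellPointed (toShift k i)
      (fun W hW => by
        have (x : NInf) : IsIso (((toShift k i).app W).app x) := hW _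
        exact NatIso.isIso_of_isIso_app _)
      V (map_toShift i V)) V

/-! ### The adjunction -/

theorem isLocallyConstant_sheafInclusion (F : AtomicSheaf k) :
    isLocallyConstant k ((sheafInclusion k).obj F) :=
  (isSheaf_iff_isLocallyConstant _).1 F.property

/-- The inclusion of sheaves into functors on `NInf` is fully faithful. -/
def sheafInclusionFullyFaithful (k : Type u) [CommRing k] : (sheafInclusion k).FullyFaithful :=
  (fullyFaithfulSheafToPresheaf _ _).comp
    (opOpEquivalence NInf).symm.congrLeft.fullyFaithfulInverse

section

variable (h : ∀ V : NMod k,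
  Presheaf.IsSheaf atomicTopology ((toPresheaf k).obj ((sigmaInf k).obj V)))

/-- The natural map `toSigmaInf`, with its target regarded as the underlying functor of a sheaf. -/
def toSigmaInfSheaf : 𝟭 (NMod k) ⟶ sigmaInfSheaf k h ⋙ sheafInclusion k := toSigmaInf k

/-- Every map from `V` to a sheaf factors uniquely through the infinite shift of `V`. -/
theorem bijective_toSigmaInfSheaf_comp (V : NMod k) (F : AtomicSheaf k) :
    Function.Bijective fun f : (sigmaInfSheaf k h).obj V ⟶ F =>
      (toSigmaInfSheaf h).app V ≫ (sheafInclusion k).map f :=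
  (isLocal_toSigmaInf V _ (isLocallyConstant_sheafInclusion F)).comp
    ((sheafInclusionFullyFaithful k).map_bijective _ _)

/-- The adjunction exhibiting the infinite shift as a reflection onto the sheaves. -/
def sigmaInfAdjunction : sigmaInfSheaf k h ⊣ sheafInclusion k :=
  Adjunction.mkOfHomEquiv
    { homEquiv := fun V F => Equiv.ofBijective _ (bijective_toSigmaInfSheaf_comp h V F)
      homEquiv_naturality_left_symm := fun {V V' F} f g => by
        have hn := (toSigmaInfSheaf h).naturality f
        have hg := Equiv.ofBijective_apply_symm_apply _ (bijective_toSigmaInfSheaf_comp h V' F) g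
        simp only [Functor.id_map, Functor.comp_map] at hn
        rw [Equiv.symm_apply_eq, Equiv.ofBijective_apply, Functor.map_comp, ← reassoc_of% hn]
        exact congrArg (f ≫ ·) hg.symm
      homEquiv_naturality_right := fun f g => by simp }

theorem sigmaInfAdjunction_unit_app (V : NMod k) :
    (sigmaInfAdjunction h).unit.app V = (toSigmaInf k).app V :=
  (congrArg (_ ≫ ·) ((sheafInclusion k).map_id _)).trans (Category.comp_id _)

end

/-- The adjunction between sheafification and the inclusion of sheaves into functors on `NInf`. -/
def sheafificationInclusionAdjunction : sheafification k ⊣ sheafInclusion k :=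
  (opOpEquivalence NInf).symm.congrLeft.toAdjunction.comp
    (sheafificationAdjunction atomicTopology (ModuleCat.{u} k))

end

end NInfty

theorem mainTheorem10 (k : Type u) [CommRing k] :
    ∃ h : ∀ V : NInfty.NMod k,
        Presheaf.IsSheaf NInfty.atomicTopology
          ((NInfty.toPresheaf k).obj ((NInfty.sigmaInf k).obj V)),
      Nonempty (NInfty.sigmaInfSheaf k h ≅ NInfty.sheafification k) ∧
      ∃ adj : NInfty.sigmaInfSheaf k h ⊣ NInfty.sheafInclusion k,
        ∀ V : NInfty.NMod k, adj.unit.app V = (NInfty.toSigmaInf k).app V := by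
  have h (V : NInfty.NMod k) := (NInfty.isSheaf_iff_isLocallyConstant _).2
    (NInfty.isLocallyConstant_sigmaInf V)
  let adj := NInfty.sigmaInfAdjunction h
  refine ⟨h, ⟨adj.leftAdjointUniq NInfty.sheafificationInclusionAdjunction⟩, adj,
    NInfty.sigmaInfAdjunction_unit_app h⟩
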